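/- Let $F$ be a field and let $Q$ be a finite quiver (finite vertex set $Q_0$, finite arrow set $Q_1$). Let $FQ$ be its path algebra: the $F$-vector space with basis all paths of $Q$, including the lazy path $e_v$ at each vertex $v$, in which the product of two paths $p,q$ is the concatenation $pq$ if $p$ ends where $q$ starts, and $0$ otherwise; its identity element is $\sum_{v\in Q_0}e_v$. An oriented cycle of $Q$ is the support of a closed path of positive length, i.e. the subquiver formed by the arrows occurring in that path and their endpoints. A polynomial identity of an $F$-algebra $A$ is an element $f$ of the free unital associative algebra $F\langle x_1,x_2,\dots\rangle$ that vanishes under all substitutions of elements of $A$ for the variables. Then: 1. $FQ$ satisfies a nonzero polynomial identity if and only if every vertex of $Q$ lies in at most one oriented cycle. 2. If every vertex of $Q$ lies in at most one oriented cycle, then the standard polynomial $$St_{2n}(x_1,\dots,x_{2n})=\sum_{\sigma\in S_{2n}}\operatorname{sgn}(\sigma)\,x_{\sigma(1)}\cdots x_{\sigma(2n)},\qquad n=|Q_0|,$$ is a polynomial identity of $FQ$. 3. If a vertex $v$ lies in two distinct oriented cycles $C_1\neq C_2$, then there are closed paths $c_1,c_2$ starting and ending at $v$ with supports $C_1$ and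 $C_2$, respectively; for every such choice, the unital subalgebra of $FQ$ generated by $c_1$ and $c_2$ is free on the two generators $c_1,c_2$. Moreover, $0$ is then the only polynomial identity of $FQ$. -/

import Mathlib

/-! Quivers are Mathlib's `Quiver V` (vertex set `V`, arrows `a ⟶ b`); paths are `Quiver.Path`,
which include the lazy paths `Quiver.Path.nil`. -/

universe u v w

namespace PIQuiver

/-- The type of all paths (lazy paths included) of a quiver, with arbitrary endpoints. -/
structure AnyPath (V : Type u) [Quiver.{v} V] where
  source : V
  target : V
  path : Quiver.Path source target

/-- The underlying space of the path algebra: the `F`-vector space with basis all paths. -/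
def PathAlgebra (F : Type w) (V : Type u) [Field F] [Quiver.{v} V] :=
  AnyPath V →₀ F

namespace PathAlgebra

noncomputable section

variable {F : Type w} {V : Type u} [Field F] [Quiver.{v} V]

instance : AddCommGroup (PathAlgebra F V) :=
  inferInstanceAs (AddCommGroup (AnyPath V →₀ F))

instance : Module F (PathAlgebra F V) :=
  inferInstanceAs (Module F (AnyPath V →₀ F))

/-- The basis element given by a path. -/
def ofPath (F : Type w) {V : Type u} [Field F] [Quiver.{v} V] {a b : V}
    (p : Quiver.Path a b) : PathAlgebra F V :=
  Finsupp.single (⟨a, b, p⟩ : AnyPath V) (1 : F)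

open Classical in
/-- The product of two basis elements: the concatenation `pq` (first `p`, then `q`) if the
target of `p` is the source of `q`, and zero otherwise. -/
def mulPath (F : Type w) {V : Type u} [Field F] [Quiver.{v} V]
    (p q : AnyPath V) : PathAlgebra F V :=
  if h : p.target = q.source then ofPath F (p.path.comp (q.path.cast h.symm rfl)) else 0

/-- The bilinear extension of `mulPath`. -/
def mulLin (F : Type w) (V : Type u) [Field F] [Quiver.{v} V] :
    PathAlgebra F V →ₗ[F] PathAlgebra F V →ₗ[F] PathAlgebra F V :=
  Finsupp.linearCombination F fun p : AnyPath V => Finsupp.linearCombination F (mulPath F p)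

instance : Mul (PathAlgebra F V) := ⟨fun x y => mulLin F V x y⟩

/-- The identity is the sum of the lazy paths. -/
instance [Fintype V] : One (PathAlgebra F V) :=
  ⟨∑ a : V, ofPath F (Quiver.Path.nil : Quiver.Path a a)⟩

theorem mul_def (x y : PathAlgebra F V) : x * y = mulLin F V x y := rfl

theorem one_def [Fintype V] :
    (1 : PathAlgebra F V) = ∑ a : V, ofPath F (Quiver.Path.nil : Quiver.Path a a) := rfl

theorem mulLin_ofPath {a b c d : V} (p : Quiver.Path a b) (q : Quiver.Path c d) :
    mulLin F V (ofPath F p) (ofPath F q) = mulPath F ⟨a, b, p⟩ ⟨c, d, q⟩ := by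
  unfold mulLin ofPath
  erw [Finsupp.linearCombination_single, one_smul, Finsupp.linearCombination_single, one_smul]

theorem ofPath_mul_ofPath {a b c : V} (p : Quiver.Path a b) (q : Quiver.Path b c) :
    ofPath F p * ofPath F q = ofPath F (p.comp q) := by
  rw [mul_def, mulLin_ofPath]
  simp [mulPath]

theorem ofPath_mul_ofPath_of_ne {a b c d : V} (p : Quiver.Path a b) (q : Quiver.Path c d)
    (h : b ≠ c) : ofPath F p * ofPath F q = 0 := by
  rw [mul_def, mulLin_ofPath]
  simp [mulPath, h]

@[elab_as_elim]
theorem induction {P : PathAlgebra F V → Prop} (zero : P 0)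
    (add : ∀ x y, P x → P y → P (x + y))
    (smul : ∀ (r : F) (a b : V) (p : Quiver.Path a b), P (r • ofPath F p))
    (x : PathAlgebra F V) : P x := by
  refine Finsupp.induction_linear (motive := P) x zero add ?_
  rintro ⟨a, b, p⟩ r
  have h := smul r a b p
  have e : r • ofPath F p = (Finsupp.single (⟨a, b, p⟩ : AnyPath V) r : AnyPath V →₀ F) := by
    unfold ofPath
    erw [Finsupp.smul_single, smul_eq_mul, mul_one]
  rwa [e] at h

protected theorem smul_mul (r : F) (x y : PathAlgebra F V) : (r • x) * y = r • (x * y) := by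
  simp [mul_def]

protected theorem mul_smul (r : F) (x y : PathAlgebra F V) : x * (r • y) = r • (x * y) := by
  simp [mul_def]

protected theorem add_mul (x y z : PathAlgebra F V) : (x + y) * z = x * z + y * z := by
  simp [mul_def]

protected theorem mul_add (x y z : PathAlgebra F V) : x * (y + z) = x * y + x * z := by
  simp [mul_def]

protected theorem zero_mul (x : PathAlgebra F V) : 0 * x = 0 := by
  simp [mul_def]

protected theorem mul_zero (x : PathAlgebra F V) : x * 0 = 0 := by
  simp [mul_def]

protected theorem mul_assoc (x y z : PathAlgebra F V) : x * y * z = x * (y * z) := by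
  induction x using PathAlgebra.induction with
  | zero => simp only [PathAlgebra.zero_mul]
  | add x x' h h' => simp only [PathAlgebra.add_mul, h, h']
  | smul r a b p =>
  induction y using PathAlgebra.induction with
  | zero => simp only [PathAlgebra.zero_mul, PathAlgebra.mul_zero]
  | add y y' h h' => simp only [PathAlgebra.add_mul, PathAlgebra.mul_add, h, h']
  | smul s c d q =>
  induction z using PathAlgebra.induction with
  | zero => simp only [PathAlgebra.mul_zero]
  | add z z' h h' => simp only [PathAlgebra.mul_add, h, h']
  | smul t e f k =>
  simp only [PathAlgebra.smul_mul, PathAlgebra.mul_smul]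
  congr 3
  by_cases h : b = c
  · subst h
    by_cases h' : d = e
    · subst h'
      simp only [ofPath_mul_ofPath, Quiver.Path.comp_assoc]
    · simp only [ofPath_mul_ofPath, ofPath_mul_ofPath_of_ne _ _ h', PathAlgebra.mul_zero]
  · by_cases h' : d = e
    · subst h'
      simp only [ofPath_mul_ofPath, ofPath_mul_ofPath_of_ne _ _ h, PathAlgebra.zero_mul]
    · simp only [ofPath_mul_ofPath_of_ne _ _ h, ofPath_mul_ofPath_of_ne _ _ h',
        PathAlgebra.zero_mul, PathAlgebra.mul_zero]

protected theorem one_mul [Fintype V] (x : PathAlgebra F V) : 1 * x = x := by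
  induction x using PathAlgebra.induction with
  | zero => simp only [PathAlgebra.mul_zero]
  | add x x' h h' => simp only [PathAlgebra.mul_add, h, h']
  | smul r a b p =>
  rw [PathAlgebra.mul_smul, one_def, mul_def, map_sum, LinearMap.sum_apply]
  simp only [← mul_def]
  rw [Finset.sum_eq_single a, ofPath_mul_ofPath, Quiver.Path.nil_comp]
  · intro c _ hc
    exact ofPath_mul_ofPath_of_ne _ _ hc
  · simp

protected theorem mul_one [Fintype V] (x : PathAlgebra F V) : x * 1 = x := by
  induction x using PathAlgebra.induction with
  | zero => simp only [PathAlgebra.zero_mul]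
  | add x x' h h' => simp only [PathAlgebra.add_mul, h, h']
  | smul r a b p =>
  rw [PathAlgebra.smul_mul, one_def, mul_def, map_sum]
  simp only [← mul_def]
  rw [Finset.sum_eq_single b, ofPath_mul_ofPath, Quiver.Path.comp_nil]
  · intro c _ hc
    exact ofPath_mul_ofPath_of_ne _ _ (Ne.symm hc)
  · simp

instance [Fintype V] : Ring (PathAlgebra F V) :=
  { (inferInstance : AddCommGroup (PathAlgebra F V)) with
    mul := fun x y => x * y
    one := 1
    left_distrib := PathAlgebra.mul_add
    right_distrib := PathAlgebra.add_mul
    zero_mul := PathAlgebra.zero_mul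
    mul_zero := PathAlgebra.mul_zero
    mul_assoc := PathAlgebra.mul_assoc
    one_mul := PathAlgebra.one_mul
    mul_one := PathAlgebra.mul_one }

instance [Fintype V] : Algebra F (PathAlgebra F V) :=
  Algebra.ofModule PathAlgebra.smul_mul PathAlgebra.mul_smul

end

end PathAlgebra

/-- A subquiver: a set of vertices and a set of arrows whose endpoints lie in it. -/
@[ext]
structure Subquiver (V : Type u) [Quiver.{v} V] where
  verts : Set V
  arrows : Set (Quiver.Total V)
  left_mem : ∀ e ∈ arrows, e.left ∈ verts
  right_mem : ∀ e ∈ arrows, e.right ∈ verts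

section Cycles

variable {V : Type u} [Quiver.{v} V]

/-- The set of arrows that occur in a path. -/
def pathArrows {a : V} : ∀ {b : V}, Quiver.Path a b → Set (Quiver.Total V)
  | _, Quiver.Path.nil => ∅
  | _, Quiver.Path.cons p e => insert ⟨_, _, e⟩ (pathArrows p)

/-- The support of a path of positive length: the subquiver formed by its arrows and by the
endpoints of its arrows. -/
def support {a b : V} (p : Quiver.Path a b) : Subquiver V where
  verts := {x | ∃ e ∈ pathArrows p, x = e.left ∨ x = e.right}
  arrows := pathArrows p
  left_mem := fun e he => ⟨e, he, Or.inl rfl⟩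
  right_mem := fun e he => ⟨e, he, Or.inr rfl⟩

/-- An oriented cycle is the support of a closed path of positive length. -/
def Subquiver.IsOrientedCycle (C : Subquiver V) : Prop :=
  ∃ (a : V) (c : Quiver.Path a a), 0 < c.length ∧ support c = C

end Cycles

/-- `f` is a polynomial identity of `A` if it vanishes under every substitution of elements of `A`
for the variables `x₀, x₁, …`. -/
def IsPolynomialIdentity (F : Type w) [Field F] (A : Type u) [Ring A] [Algebra F A]
    (f : FreeAlgebra F ℕ) : Prop :=
  ∀ a : ℕ → A, FreeAlgebra.lift F a f = 0

/-- `A` is a PI-algebra if it has a nonzero polynomial identity. -/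
def IsPI (F : Type w) [Field F] (A : Type u) [Ring A] [Algebra F A] : Prop :=
  ∃ f : FreeAlgebra F ℕ, f ≠ 0 ∧ IsPolynomialIdentity F A f

/-- The standard polynomial of degree `n`, in the variables `x₀, …, xₙ₋₁`. -/
noncomputable def standardPolynomial (F : Type w) [Field F] (n : ℕ) : FreeAlgebra F ℕ :=
  ∑ σ : Equiv.Perm (Fin n), ((Equiv.Perm.sign σ : ℤˣ) : ℤ) •
    (List.ofFn fun i : Fin n => FreeAlgebra.ι F ((σ i : Fin n) : ℕ)).prod

end PIQuiver

/-! If the cycles are disjoint, a path is determined by its endpoints and the multiset of its arrows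
(`DisjointCycles.eq_of_perm`). Hence sending a path from `a` to `b` to the commutative monomial of
its arrows, placed in entry `(a, b)`, represents the path algebra faithfully by matrices over a
polynomial ring (`toMatrixLin_injective`), and the Amitsur–Levitzki theorem `standardEval_matrix`
supplies the identity.

That theorem follows Rosset's argument. Over `ℚ`, attach an exterior generator to each matrix and
let `A` be the sum. The entries of `A ^ 2` commute, and anticommutation makes the traces of its
powers vanish, so `A` is nilpotent; the top exterior coefficient of its power is the standard
polynomial. Multilinearity carries the result from integral matrix units to every commutative ring.

Conversely, distinct cycles through `v` give closed paths whose arrow words do not commute, since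
commuting nonempty words have the same letters. Words that do not commute generate a free monoid,
and since paths form a basis, the closed paths generate a free algebra. A free monoid on two letters
contains one on countably many, so no nonzero polynomial vanishes identically. -/

/-! ### Traces of powers and nilpotency -/

open Polynomial in
/-- **Jacobi's formula** for matrices of polynomials. -/
theorem Matrix.derivative_det {R n : Type*} [CommRing R] [Fintype n] [DecidableEq n]
    (N : Matrix n n R[X]) :
    derivative N.det = (N.adjugate * N.map derivative).trace := by
  have h : ∀ i, (N.adjugate * N.map derivative) i i
      = (N.updateCol i fun k => derivative (N k i)).det := by
    intro i
    rw [← Matrix.cramer_apply, Matrix.cramer_eq_adjugate_mulVec]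
    rfl
  rw [Matrix.trace]
  simp only [Matrix.diag_apply, h, Matrix.det_apply, map_sum]
  rw [Finset.sum_comm]
  refine Finset.sum_congr rfl fun σ _ => ?_
  rw [← Finset.smul_sum, Units.smul_def, Units.smul_def, map_zsmul, derivative_prod_finset]
  congr 1
  refine Finset.sum_congr rfl fun i _ => ?_
  rw [← Finset.mul_prod_erase _ _ (Finset.mem_univ i), mul_comm, Matrix.updateCol_self]
  congr 1
  refine Finset.prod_congr rfl fun j hj => ?_
  rw [Matrix.updateCol_ne (Finset.ne_of_mem_erase hj)]

open Polynomial in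
/-- A matrix over a commutative `ℚ`-algebra all of whose positive powers are traceless is
nilpotent. -/
theorem Matrix.pow_card_eq_zero_of_trace_pow_eq_zero {S n : Type*} [CommRing S] [Algebra ℚ S]
    [Fintype n] [DecidableEq n] (B : Matrix n n S)
    (hB : ∀ k, 0 < k → (B ^ k).trace = 0) : B ^ Fintype.card n = 0 := by
  -- `D k` is the coefficient of `X ^ k` in the adjugate of `X - B`. Comparing coefficients in `(X -
  -- B) * adj = charpoly` gives the recursion below.
  set D : ℕ → Matrix n n S := fun k => B.charmatrix.adjugate.map fun p => p.coeff k with hD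
  have hkey : ∀ i j, X * B.charmatrix.adjugate i j
      = ∑ l, C (B i l) * B.charmatrix.adjugate l j
        + B.charpoly * C ((1 : Matrix n n S) i j) := by
    intro i j
    have h := B.charmatrix.mul_adjugate
    set N := B.charmatrix.adjugate
    rw [Matrix.charmatrix, sub_mul, sub_eq_iff_eq_add] at h
    have h' := congrFun (congrFun h i) j
    rw [Matrix.scalar_apply, Matrix.diagonal_mul, Matrix.add_apply, Matrix.mul_apply] at h'
    rw [h', add_comm]
    congr 1
    rw [Matrix.smul_apply, smul_eq_mul]
    congr 1
    simp [Matrix.one_apply, apply_ite C]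
  have hrec : ∀ k, D k = B * D (k + 1) + B.charpoly.coeff (k + 1) • (1 : Matrix n n S) := by
    intro k
    ext i j
    have h := congrArg (fun p : S[X] => p.coeff (k + 1)) (hkey i j)
    simpa [hD, Matrix.mul_apply] using h
  have hzero : B * D 0 + B.charpoly.coeff 0 • (1 : Matrix n n S) = 0 := by
    ext i j
    have h := congrArg (fun p : S[X] => p.coeff 0) (hkey i j)
    simpa [hD, Matrix.mul_apply] using h.symm
  have hlarge : ∃ K, ∀ k, K ≤ k → D k = 0 := by
    refine ⟨(Finset.univ.sup fun i => Finset.univ.sup fun j =>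
      (B.charmatrix.adjugate i j).natDegree) + 1, fun k hk => ?_⟩
    ext i j
    refine coeff_eq_zero_of_natDegree_lt (lt_of_lt_of_le (Nat.lt_succ_of_le ?_) hk)
    exact (Finset.le_sup (f := fun j => (B.charmatrix.adjugate i j).natDegree)
      (Finset.mem_univ j)).trans (Finset.le_sup (f := fun i => Finset.univ.sup fun j =>
        (B.charmatrix.adjugate i j).natDegree) (Finset.mem_univ i))
  obtain ⟨K, hK⟩ := hlarge
  -- Induction downwards from `K`, with `d` bounding the distance. The exponent `m` must vary,
  -- because each use of the recursion brings out another factor `B`.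
  have htr : ∀ d k, K ≤ k + d → ∀ m, 0 < m → (B ^ m * D k).trace = 0 := by
    intro d
    induction d with
    | zero => intro k hk m _; rw [hK k hk]; simp
    | succ d ih =>
      intro k hk m hm
      rw [hrec k, mul_add, ← mul_assoc, ← pow_succ, Matrix.trace_add,
        ih (k + 1) (by omega) (m + 1) (by omega)]
      simp [Matrix.trace_smul, hB m hm]
  have htr1 : ∀ k, (B * D k).trace = 0 := fun k => by
    simpa using htr K k (by omega) 1 one_pos
  have hder : ∀ k, (D k).trace = B.charpoly.coeff (k + 1) * (k + 1) := by
    intro k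
    rw [← coeff_derivative, Matrix.charpoly, Matrix.derivative_det]
    have : B.charmatrix.map (derivative : S[X] → S[X]) = 1 := by
      ext i j : 2
      by_cases hij : i = j
      · subst hij; simp [Matrix.charmatrix_apply_eq]
      · simp [Matrix.charmatrix_apply_ne, hij]
    rw [this, mul_one]
    simp [Matrix.trace, hD]
  have hcancel : ∀ (q : ℚ) (c : S), q ≠ 0 → q • c = 0 → c = 0 := by
    intro q c hq h
    rw [← one_smul ℚ c, ← inv_mul_cancel₀ hq, mul_smul, h, smul_zero]
  -- Taking traces in the recursion and comparing with Jacobi's formula gives `k * c = card n * c`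
  -- for the coefficient `c` of `X ^ k`; rational scalars allow cancelling `k - card n`. The
  -- constant coefficient is not seen by the derivative and comes from `hzero`.
  have hcoeff : ∀ k, k ≠ Fintype.card n → B.charpoly.coeff k = 0 := by
    intro k hk
    rcases k with _ | k
    · have h := congrArg Matrix.trace hzero
      rw [Matrix.trace_add, htr1, zero_add, Matrix.trace_smul, Matrix.trace_one,
        Matrix.trace_zero, smul_eq_mul] at h
      refine hcancel (Fintype.card n : ℚ) _ (by exact_mod_cast hk.symm) ?_
      rw [Algebra.smul_def, mul_comm]
      simpa using h
    · have h := congrArg Matrix.trace (hrec k)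
      rw [Matrix.trace_add, htr1, zero_add, Matrix.trace_smul, Matrix.trace_one, hder,
        smul_eq_mul, ← sub_eq_zero, ← mul_sub] at h
      refine hcancel (((k + 1 : ℕ) : ℚ) - (Fintype.card n : ℚ)) _ ?_ ?_
      · rw [sub_ne_zero]; exact_mod_cast hk
      · rw [Algebra.smul_def, mul_comm]
        simpa using h
  have hpoly : B.charpoly = X ^ Fintype.card n := by
    nontriviality S
    ext k
    rw [coeff_X_pow]
    split_ifs with h
    · rw [h]
      have := B.charpoly_monic.coeff_natDegree
      rwa [Matrix.charpoly_natDegree_eq_dim] at this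
    · exact hcoeff k h
  have := B.aeval_self_charpoly
  rwa [hpoly, map_pow, aeval_X] at this

/-! ### Matrices with anticommuting entries -/

open ExteriorAlgebra in
theorem ExteriorAlgebra.commute_ι_mul_ι {R M : Type*} [CommRing R] [AddCommGroup M] [Module R M]
    (x y z : M) : Commute (ι R x * ι R y) (ι R z) := by
  have h : ∀ a b : M, ι R a * ι R b = -(ι R b * ι R a) := fun a b =>
    eq_neg_of_add_eq_zero_left (ι_add_mul_swap a b)
  rw [commute_iff_eq, mul_assoc, h y z, mul_neg, ← mul_assoc, h x z, neg_mul, neg_neg, mul_assoc]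

/-- Cyclicity of the trace with a sign: carrying the first factor to the end passes one
anticommuting entry and one commuting entry. -/
theorem Matrix.trace_mul_mul_of_anticommute {R n : Type*} [Ring R] [Fintype n]
    {A β : Matrix n n R} (hA : ∀ i j k l, A i j * A k l = -(A k l * A i j))
    (hβ : ∀ i j k l, β i j * A k l = A k l * β i j) :
    (A * A * β).trace = -(A * β * A).trace := by
  simp only [Matrix.trace, Matrix.diag_apply, Matrix.mul_apply, Finset.sum_mul,
    ← Finset.sum_neg_distrib]
  rw [Finset.sum_comm' (s := Finset.univ) (t := fun _ => Finset.univ)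
    (t' := Finset.univ) (s' := fun _ => Finset.univ) (by simp)]
  rw [Finset.sum_comm]
  conv_lhs => enter [2, i]; rw [Finset.sum_comm]
  rw [Finset.sum_comm]
  refine Finset.sum_congr rfl fun j _ => Finset.sum_congr rfl fun i _ =>
    Finset.sum_congr rfl fun l _ => ?_
  rw [mul_assoc (A j l), hβ, ← mul_assoc, ← neg_mul, ← hA]

/-- A square matrix with anticommuting entries, whose square has entries in a commutative
`ℚ`-algebra of elements that commute with the entries, is nilpotent. -/
theorem Matrix.pow_two_mul_card_eq_zero_of_anticommute {S T n : Type*} [CommRing S] [Algebra ℚ S]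
    [Ring T] [Algebra ℚ T] [Fintype n] [DecidableEq n] (f : S →+* T) (hf : Function.Injective f)
    (A : Matrix n n T) (B : Matrix n n S) (hB : B.map f = A ^ 2)
    (hA : ∀ i j k l, A i j * A k l = -(A k l * A i j))
    (hfA : ∀ s k l, f s * A k l = A k l * f s) : A ^ (2 * Fintype.card n) = 0 := by
  have hpow : ∀ k, (B ^ k).map f = A ^ (2 * k) := by
    intro k
    rw [pow_mul, ← RingHom.mapMatrix_apply, map_pow, RingHom.mapMatrix_apply, hB]
  have htrace : ∀ k, 0 < k → (B ^ k).trace = 0 := by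
    intro k hk
    obtain ⟨k, rfl⟩ := Nat.exists_eq_succ_of_ne_zero hk.ne'
    apply hf
    rw [AddMonoidHom.map_trace f, map_zero]
    have h1 : (B ^ (k + 1)).map f = A * A * A ^ (2 * k) := by
      rw [hpow, ← pow_two, ← pow_add]; congr 1; omega
    -- Carrying one `A` around an even power of `A` returns the same power, so the trace equals its
    -- own negative.
    have h2 : (A * A * A ^ (2 * k)).trace = -(A * A * A ^ (2 * k)).trace := by
      conv_rhs => rw [mul_assoc, ← pow_succ', pow_succ, ← mul_assoc]
      refine Matrix.trace_mul_mul_of_anticommute hA fun i j k' l => ?_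
      rw [← hpow]
      exact hfA _ _ _
    have h3 : (2 : ℚ) • (A * A * A ^ (2 * k)).trace = 0 := by
      rw [two_smul]
      nth_rewrite 1 [h2]
      exact neg_add_cancel _
    change ((B ^ (k + 1)).map f).trace = 0
    rw [h1]
    have h4 := congrArg (fun t => (2⁻¹ : ℚ) • t) h3
    simpa [smul_smul] using h4
  rw [← hpow, Matrix.pow_card_eq_zero_of_trace_pow_eq_zero B htrace]
  ext; simp

/-- A square matrix of vectors raised to an even power vanishes in the exterior algebra. -/
theorem ExteriorAlgebra.matrix_pow_eq_zero {M n : Type*} [AddCommGroup M] [Module ℚ M]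
    [Fintype n] [DecidableEq n] (v : Matrix n n M) :
    (v.map (ExteriorAlgebra.ι ℚ)) ^ (2 * Fintype.card n) = 0 := by
  -- Products of two vectors commute with every vector, so they generate a commutative algebra,
  -- which serves as the ring of scalars for the square of the matrix.
  set s : Set (ExteriorAlgebra ℚ M) :=
    Set.range fun p : M × M => ExteriorAlgebra.ι ℚ p.1 * ExteriorAlgebra.ι ℚ p.2 with hs
  have hcent : ∀ z, ∀ x ∈ Algebra.adjoin ℚ s, x * ExteriorAlgebra.ι ℚ z
      = ExteriorAlgebra.ι ℚ z * x := by
    intro z x hx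
    have hle : Algebra.adjoin ℚ s ≤ Subalgebra.centralizer ℚ {ExteriorAlgebra.ι ℚ z} := by
      refine Algebra.adjoin_le ?_
      rintro _ ⟨p, rfl⟩
      rw [SetLike.mem_coe, Subalgebra.mem_centralizer_iff]
      rintro _ rfl
      exact (commute_ι_mul_ι p.1 p.2 z).eq.symm
    have := hle hx
    rw [Subalgebra.mem_centralizer_iff] at this
    exact (this _ rfl).symm
  have hcomm : ∀ x ∈ s, ∀ y ∈ s, x * y = y * x := by
    rintro _ ⟨p, rfl⟩ _ ⟨q, rfl⟩
    exact ((commute_ι_mul_ι p.1 p.2 q.1).mul_right (commute_ι_mul_ι p.1 p.2 q.2)).eq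
  have hmul : IsMulCommutative (Algebra.adjoin ℚ s) := Algebra.isMulCommutative_adjoin ℚ hcomm
  let _ : CommRing (Algebra.adjoin ℚ s) :=
    { (inferInstance : Ring (Algebra.adjoin ℚ s)) with mul_comm := hmul.is_comm.comm }
  have hmem : ∀ i j, ((v.map (ExteriorAlgebra.ι ℚ)) ^ 2) i j ∈ Algebra.adjoin ℚ s := by
    intro i j
    rw [pow_two, Matrix.mul_apply]
    exact Subalgebra.sum_mem _ fun k _ => Algebra.subset_adjoin ⟨(v i k, v k j), rfl⟩
  exact Matrix.pow_two_mul_card_eq_zero_of_anticommute (S := Algebra.adjoin ℚ s)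
    (Algebra.adjoin ℚ s).val.toRingHom Subtype.val_injective _
    (Matrix.of fun i j => ⟨_, hmem i j⟩) rfl
    (fun i j k l => eq_neg_of_add_eq_zero_left (ExteriorAlgebra.ι_add_mul_swap _ _))
    (fun x k l => hcent (v k l) x.1 x.2)

/-! ### The Amitsur–Levitzki theorem -/

/-- The standard polynomial evaluated at a tuple. -/
noncomputable def standardEval {A : Type*} [Ring A] {m : ℕ} (a : Fin m → A) : A :=
  ∑ σ : Equiv.Perm (Fin m), ((Equiv.Perm.sign σ : ℤˣ) : ℤ) • (List.ofFn fun i => a (σ i)).prod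

theorem map_standardEval {A B G : Type*} [Ring A] [Ring B] [FunLike G A B] [RingHomClass G A B]
    (f : G) {m : ℕ} (a : Fin m → A) : f (standardEval a) = standardEval fun i => f (a i) := by
  simp [standardEval, map_sum, map_list_prod, List.map_ofFn, Function.comp_def]

theorem List.prod_ofFn_matrix_map_smul {R T n : Type*} [CommRing R] [Ring T] [Algebra R T]
    [Fintype n] [DecidableEq n] {k : ℕ} (A : Fin k → Matrix n n R) (e : Fin k → T) :
    (List.ofFn fun j => (A j).map fun q => q • e j).prod
      = (List.ofFn A).prod.map fun q => q • (List.ofFn e).prod := by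
  induction k with
  | zero => ext i j; by_cases h : i = j <;> simp [h]
  | succ k ih =>
    rw [List.ofFn_succ, List.prod_cons, ih, List.ofFn_succ, List.prod_cons, List.ofFn_succ,
      List.prod_cons]
    ext i j
    simp only [Matrix.mul_apply, Matrix.map_apply, Finset.sum_smul, smul_mul_smul_comm]

/-- Expanding the power of `∑ A i ⊗ e i` gives a sum over all index maps `r`. A repeated index kills
the exterior product and a permutation contributes its sign, so what remains is the standard
polynomial. -/
theorem standardEval_matrix_rat {n : Type*} [Fintype n] [DecidableEq n]
    {m : ℕ} (hm : m = 2 * Fintype.card n) (A : Fin m → Matrix n n ℚ) : standardEval A = 0 := by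
  let v : Matrix n n (Fin m → ℚ) := fun a b i => A i a b
  let e : Fin m → ExteriorAlgebra ℚ (Fin m → ℚ) := fun i => ExteriorAlgebra.ι ℚ (Pi.single i 1)
  have hsum : v.map (ExteriorAlgebra.ι ℚ) = ∑ i, (A i).map fun q => q • e i := by
    ext a b
    rw [Matrix.sum_apply]
    simp only [Matrix.map_apply, e, ← map_smul, ← map_sum]
    congr 1
    ext i
    simp [v, Finset.sum_apply, Pi.single_apply]
  have hpow := ExteriorAlgebra.matrix_pow_eq_zero v
  rw [← hm, hsum, ← MultilinearMap.mkPiAlgebraFin_apply_const (R := ℤ), MultilinearMap.map_sum]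
    at hpow
  simp only [MultilinearMap.mkPiAlgebraFin_apply] at hpow
  -- The functional reading off the coefficient of the top exterior product: the determinant in
  -- degree `m`, zero in every other degree.
  let φ : ExteriorAlgebra ℚ (Fin m → ℚ) →ₗ[ℚ] ℚ :=
    ExteriorAlgebra.liftAlternating (Pi.single m Matrix.detRowAlternating)
  have hφ : ∀ r : Fin m → Fin m, φ (List.ofFn fun j => e (r j)).prod
      = (Matrix.of fun j => Pi.single (r j) (1 : ℚ)).det := by
    intro r
    rw [← ExteriorAlgebra.ιMulti_apply, ExteriorAlgebra.liftAlternating_apply_ιMulti]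
    simp only [Pi.single_eq_same]
    rfl
  ext a b
  have h := congrArg φ (congrFun (congrFun hpow a) b)
  simp only [List.prod_ofFn_matrix_map_smul (fun j => A _) (fun j => e _)] at h
  rw [Matrix.sum_apply, map_sum] at h
  simp only [Matrix.map_apply, map_smul, hφ, Matrix.zero_apply, map_zero, smul_eq_mul] at h
  rw [Matrix.zero_apply, ← h, standardEval, Matrix.sum_apply]
  refine Finset.sum_of_injOn (fun σ : Equiv.Perm (Fin m) => (σ : Fin m → Fin m))
    (fun σ _ τ _ h => DFunLike.coe_injective h) (by simp) ?_ ?_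
  · intro r _ hr
    have hni : ¬ Function.Injective r := fun hi =>
      hr ⟨Equiv.ofBijective r (Finite.injective_iff_bijective.1 hi), by simp, rfl⟩
    rw [Function.not_injective_iff] at hni
    obtain ⟨i, j, hij, hne⟩ := hni
    exact mul_eq_zero_of_right _ (Matrix.det_zero_of_row_eq hne (by ext k; simp [hij]))
  · intro σ _
    have : (Matrix.of fun j => Pi.single (σ j) (1 : ℚ)) = σ.permMatrix ℚ := by
      ext i j
      simp [Equiv.Perm.permMatrix, PEquiv.toMatrix_apply, Pi.single_apply, eq_comm]
    rw [this, Matrix.det_permutation, Matrix.smul_apply, zsmul_eq_mul, mul_comm]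

/-- The **Amitsur–Levitzki theorem**. -/
theorem standardEval_matrix {R n : Type*} [CommRing R] [Fintype n] [DecidableEq n]
    (A : Fin (2 * Fintype.card n) → Matrix n n R) : standardEval A = 0 := by
  have hint : ∀ A : Fin (2 * Fintype.card n) → Matrix n n ℤ, standardEval A = 0 := by
    intro A
    have hinj : Function.Injective (Int.castRingHom ℚ).mapMatrix :=
      Matrix.map_injective (m := n) (n := n) (Int.castRingHom ℚ).injective_int
    apply hinj
    rw [map_standardEval, map_zero, standardEval_matrix_rat rfl]
  have halt : ∀ B : Fin (2 * Fintype.card n) → Matrix n n R, standardEval B =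
      (MultilinearMap.alternatization (MultilinearMap.mkPiAlgebraFin R _ (Matrix n n R))) B := by
    intro B
    simp [standardEval, MultilinearMap.alternatization_apply, Units.smul_def]
  have hzero : (MultilinearMap.alternatization
      (MultilinearMap.mkPiAlgebraFin R (2 * Fintype.card n) (Matrix n n R))).toMultilinearMap
      = 0 := by
    -- Matrix units are images of integral matrices, for which the identity is already known.
    refine Module.Basis.ext_multilinear (fun _ => Matrix.stdBasis R n n) fun w => ?_
    have h := congrArg (Int.castRingHom R).mapMatrix
      (hint fun i => Matrix.single (w i).1 (w i).2 1)
    rw [map_standardEval, map_zero, halt] at h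
    have hw : (fun i => Matrix.stdBasis R n n (w i)) =
        fun i => (Int.castRingHom R).mapMatrix (Matrix.single (w i).1 (w i).2 1) := by
      ext i : 1
      rw [Matrix.stdBasis_eq_single, RingHom.mapMatrix_apply, Matrix.map_single, map_one]
    rw [hw]
    exact h
  rw [halt]
  exact congrArg (fun f => f A) hzero


/-! ### Combinatorics on words -/

/-- A Euclidean descent: in such a relation the shorter word is a prefix of the longer, say `w = u
++ d`. Cancelling `u` leaves a relation of the same kind between `u` and `d`, of smaller total
length, and `u` commutes with `w` once it commutes with `d`. -/
theorem List.append_comm_of_flatMap_cond_eq {α : Type*} (u w : List α) :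
    ∀ x y : List Bool, (u ++ x.flatMap fun b => cond b w u) = (w ++ y.flatMap fun b => cond b w u) →
      u ++ w = w ++ u := by
  induction hN : u.length + w.length using Nat.strong_induction_on generalizing u w with
  | _ N ih =>
  -- the case where the first word is the shorter one
  have key : ∀ u w : List α, u.length + w.length = N → u.length ≤ w.length →
      ∀ x y : List Bool, (u ++ x.flatMap fun b => cond b w u)
        = (w ++ y.flatMap fun b => cond b w u) → u ++ w = w ++ u := by
    intro u w hN hle x y h
    by_cases hu : u = []
    · simp [hu]
    obtain ⟨d, rfl⟩ : u <+: w :=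
      List.prefix_of_prefix_length_le ⟨_, rfl⟩ ⟨_, h.symm⟩ hle
    have hsub : ∀ z : List Bool, (z.flatMap fun b => cond b (u ++ d) u)
        = (z.flatMap fun b => cond b [false, true] [false]).flatMap fun b => cond b d u := by
      intro z
      induction z with
      | nil => rfl
      | cons b z ihz => cases b <;> simp [ihz]
    rw [List.append_assoc, List.append_cancel_left_eq] at h
    have hd : u ++ d = d ++ u := by
      rcases x with _ | ⟨b, x⟩
      · have : d = [] := (List.append_eq_nil_iff.1 h.symm).1
        simp [this]
      · have hpos : 0 < u.length := List.length_pos_iff.2 hu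
        rw [hsub, hsub] at h
        obtain ⟨x', hx'⟩ : ∃ x', ((b :: x).flatMap fun b => cond b [false, true] [false])
            = false :: x' := by cases b <;> simp
        rw [hx'] at h
        refine ih (u.length + d.length) ?_ u d rfl x' _ (by simpa using h)
        simp only [List.length_append] at hN
        omega
    rw [List.append_assoc, ← hd]
  intro x y h
  rcases le_total u.length w.length with hle | hle
  · exact key u w hN hle x y h
  · have hswap : ∀ z : List Bool, (z.flatMap fun b => cond b w u)
        = (z.map not).flatMap fun b => cond b u w := by
      intro z
      induction z with
      | nil => rfl
      | cons b z ihz => cases b <;> simp [ihz]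
    rw [hswap, hswap] at h
    exact (key w u (by omega) hle _ _ h.symm).symm

/-- Two words that do not commute generate a free monoid. -/
theorem List.flatMap_cond_injective {α : Type*} {u w : List α} (h : u ++ w ≠ w ++ u) :
    Function.Injective fun x : List Bool => x.flatMap fun b => cond b w u := by
  have hu : u ≠ [] := by rintro rfl; simp at h
  have hw : w ≠ [] := by rintro rfl; simp at h
  intro x
  induction x with
  | nil =>
    intro y hxy
    rcases y with _ | ⟨b, y⟩
    · rfl
    · cases b <;> simp_all
  | cons a x ih =>
    intro y hxy
    rcases y with _ | ⟨b, y⟩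
    · cases a <;> simp_all
    · cases a <;> cases b
      · simp only [List.flatMap_cons, cond_false, List.append_cancel_left_eq] at hxy
        rw [ih hxy]
      -- Differing first letters would give a relation that forces `u` and `w` to commute.
      · exact absurd (List.append_comm_of_flatMap_cond_eq u w x y hxy) h
      · exact absurd (List.append_comm_of_flatMap_cond_eq u w y x hxy.symm) h
      · simp only [List.flatMap_cons, cond_true, List.append_cancel_left_eq] at hxy
        rw [ih hxy]

/-- Commuting nonempty words have the same letters. -/
theorem List.mem_iff_of_append_comm {α : Type*} {u w : List α} (hu : u ≠ []) (hw : w ≠ [])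
    (h : u ++ w = w ++ u) (a : α) : a ∈ u ↔ a ∈ w := by
  have hpow : ∀ (v : List α) (k : ℕ), 0 < k → (a ∈ (List.replicate k v).flatten ↔ a ∈ v) := by
    intro v k hk
    simp [List.mem_flatten, List.mem_replicate, hk.ne']
  have hcomm : ∀ (k : ℕ), (List.replicate k u).flatten ++ w = w ++ (List.replicate k u).flatten := by
    intro k
    induction k with
    | zero => simp
    | succ k ih =>
      rw [List.replicate_succ, List.flatten_cons, List.append_assoc, ih, ← List.append_assoc, h,
        List.append_assoc]
  have hcomm2 : ∀ (k l : ℕ), (List.replicate k u).flatten ++ (List.replicate l w).flatten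
      = (List.replicate l w).flatten ++ (List.replicate k u).flatten := by
    intro k l
    induction l with
    | zero => simp
    | succ l ih =>
      rw [List.replicate_succ, List.flatten_cons, ← List.append_assoc, hcomm, List.append_assoc, ih,
        List.append_assoc]
  -- The powers `u ^ |w|` and `w ^ |u|` commute and have the same length, hence coincide.
  have heq := (List.append_inj (hcomm2 w.length u.length) (by simp [mul_comm])).1
  rw [← hpow u w.length (List.length_pos_iff.2 hw), heq, hpow w _ (List.length_pos_iff.2 hu)]

/-- The words `1…10` form a code. -/
theorem List.flatMap_replicate_injective :
    Function.Injective fun x : List ℕ => x.flatMap fun n => List.replicate n true ++ [false] := by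
  have haux : ∀ (m n : ℕ) (s t : List Bool), List.replicate m true ++ false :: s
      = List.replicate n true ++ false :: t → m = n ∧ s = t := by
    intro m
    induction m with
    | zero => intro n s t h; cases n <;> simp_all [List.replicate_succ]
    | succ m ih =>
      intro n s t h
      cases n with
      | zero => simp [List.replicate_succ] at h
      | succ n =>
        simp only [List.replicate_succ, List.cons_append, List.cons.injEq, true_and] at h
        have := ih n s t h
        exact ⟨by omega, this.2⟩
  intro x
  induction x with
  | nil => intro y h; cases y <;> simp_all
  | cons m x ih =>
    intro y h
    cases y with
    | nil => simp at h
    | cons n y =>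
      simp only [List.flatMap_cons, List.append_assoc, List.cons_append, List.nil_append] at h
      obtain ⟨rfl, h2⟩ := haux _ _ _ _ h
      rw [ih h2]

/-! ### Paths as words of arrows, and oriented cycles -/

namespace PIQuiver

variable {V : Type u} [Quiver.{v} V]

/-- The list of arrows of a path. -/
def arrowList {a : V} : ∀ {b : V}, Quiver.Path a b → List (Quiver.Total V)
  | _, Quiver.Path.nil => []
  | _, Quiver.Path.cons p e => arrowList p ++ [⟨_, _, e⟩]

@[simp]
theorem arrowList_nil {a : V} : arrowList (Quiver.Path.nil : Quiver.Path a a) = [] := rfl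

@[simp]
theorem arrowList_cons {a b c : V} (p : Quiver.Path a b) (e : b ⟶ c) :
    arrowList (p.cons e) = arrowList p ++ [⟨_, _, e⟩] := rfl

@[simp]
theorem arrowList_comp {a b c : V} (p : Quiver.Path a b) (q : Quiver.Path b c) :
    arrowList (p.comp q) = arrowList p ++ arrowList q := by
  induction q with
  | nil => simp
  | cons q e ih => simp [ih]

theorem length_arrowList {a b : V} (p : Quiver.Path a b) : (arrowList p).length = p.length := by
  induction p with
  | nil => rfl
  | cons p e ih => simp [ih]

theorem mem_pathArrows {a b : V} (p : Quiver.Path a b) (x : Quiver.Total V) :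
    x ∈ pathArrows p ↔ x ∈ arrowList p := by
  induction p with
  | nil => simp [pathArrows]
  | cons p e ih => simp [pathArrows, ih, or_comm]

theorem arrowList_injective {a b : V} :
    Function.Injective (arrowList : Quiver.Path a b → List (Quiver.Total V)) := by
  intro p
  induction p with
  | nil =>
    intro q h
    exact (Quiver.Path.eq_nil_of_length_zero q (by rw [← length_arrowList, ← h]; rfl)).symm
  | cons p e ih =>
    intro q h
    cases q with
    | nil => simp at h
    | cons q f =>
      simp only [arrowList_cons] at h
      obtain ⟨h1, h2⟩ := List.append_inj' h rfl
      simp only [List.cons.injEq, and_true] at h2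
      cases h2
      rw [ih h1]

/-- The path is cut at the first occurrence of `x`; that the initial piece avoids `x` is what later
separates two cycles. -/
theorem exists_comp_of_mem_arrowList {a b : V} (p : Quiver.Path a b) {x : Quiver.Total V}
    (hx : x ∈ arrowList p) : ∃ (p₁ : Quiver.Path a x.left) (p₂ : Quiver.Path x.right b),
      p = (p₁.cons x.hom).comp p₂ ∧ x ∉ arrowList p₁ := by
  induction p with
  | nil => simp at hx
  | cons p e ih =>
    by_cases h : x ∈ arrowList p
    · obtain ⟨p₁, p₂, rfl, h'⟩ := ih h
      exact ⟨p₁, p₂.cons e, rfl, h'⟩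
    · rw [arrowList_cons, List.mem_append, List.mem_singleton] at hx
      rcases hx with hx | rfl
      · exact absurd hx h
      · exact ⟨p, Quiver.Path.nil, rfl, h⟩

theorem arrows_support {a b : V} (p : Quiver.Path a b) :
    (support p).arrows = {x | x ∈ arrowList p} :=
  Set.ext fun x => mem_pathArrows p x

theorem support_eq_iff {a b c d : V} (p : Quiver.Path a b) (q : Quiver.Path c d) :
    support p = support q ↔ ∀ x, x ∈ arrowList p ↔ x ∈ arrowList q := by
  constructor
  · intro h x
    have := congrArg (fun C => x ∈ Subquiver.arrows C) h
    simpa [arrows_support] using this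
  · intro h
    have : pathArrows p = pathArrows q := Set.ext fun x => by
      rw [mem_pathArrows, mem_pathArrows, h]
    ext x <;> simp [support, this]

/-- The condition that every vertex lies in at most one oriented cycle. -/
def DisjointCycles (V : Type u) [Quiver.{v} V] : Prop :=
  ∀ v : V, {C : Subquiver V | C.IsOrientedCycle ∧ v ∈ C.verts}.Subsingleton

/-- A closed path may be rotated to start at any vertex on it without changing its arrows. -/
theorem exists_closed_path_of_mem_verts {v : V} {C : Subquiver V} (hC : C.IsOrientedCycle)
    (hv : v ∈ C.verts) : ∃ c : Quiver.Path v v, support c = C := by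
  obtain ⟨a, c, -, rfl⟩ := hC
  obtain ⟨e, he, hev⟩ := hv
  rw [mem_pathArrows] at he
  obtain ⟨p₁, p₂, rfl, -⟩ := exists_comp_of_mem_arrowList c he
  rcases hev with rfl | rfl
  · refine ⟨(e.hom.toPath.comp p₂).comp p₁, (support_eq_iff _ _).2 fun x => ?_⟩
    simp [Quiver.Hom.toPath]
    tauto
  · refine ⟨p₂.comp (p₁.cons e.hom), (support_eq_iff _ _).2 fun x => ?_⟩
    simp
    tauto

theorem mem_verts_support {v : V} (c : Quiver.Path v v) {x : Quiver.Total V}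
    (hx : x ∈ arrowList c) (hv : x.left = v) : v ∈ (support c).verts :=
  ⟨x, (mem_pathArrows c x).2 hx, Or.inl hv.symm⟩

theorem isOrientedCycle_support {v : V} (c : Quiver.Path v v) {x : Quiver.Total V}
    (hx : x ∈ arrowList c) : (support c).IsOrientedCycle :=
  ⟨v, c, by rw [← length_arrowList]; exact List.length_pos_of_mem hx, rfl⟩

/-- When the cycles are disjoint, a path is determined by its endpoints and by the multiset of
its arrows. -/
theorem DisjointCycles.eq_of_perm (h : DisjointCycles V) {a b : V} (p q : Quiver.Path a b)
    (hpq : (arrowList p).Perm (arrowList q)) : p = q := by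
  induction hN : p.length generalizing a with
  | zero =>
    have hp := length_arrowList p
    rw [hN, List.length_eq_zero_iff] at hp
    apply arrowList_injective
    rw [hp] at hpq ⊢
    exact hpq.nil_eq
  | succ N ih =>
    have hlen : p.length = q.length := by
      rw [← length_arrowList, ← length_arrowList, hpq.length_eq]
    obtain ⟨c, e, p', hp', rfl⟩ := p.eq_toPath_comp_of_length_eq_succ hN
    obtain ⟨d, f, q', hq', rfl⟩ := q.eq_toPath_comp_of_length_eq_succ (hlen.symm.trans hN)
    have hE : ∀ {c : V} (e : a ⟶ c) (p' : Quiver.Path c b),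
        arrowList (e.toPath.comp p') = (⟨_, _, e⟩ : Quiver.Total V) :: arrowList p' := by
      intro c e p'
      simp [Quiver.Hom.toPath]
    by_cases hef : (⟨_, _, e⟩ : Quiver.Total V) = ⟨_, _, f⟩
    · cases hef
      rw [hE, hE, List.perm_cons] at hpq
      rw [ih p' q' hpq hp']
    -- If the first arrows `e ≠ f` differ, each occurs later in the other path. Following `p` until
    -- just before its first `f` gives a closed path at `a` that avoids `f`; following `q` until
    -- just before its first `e` gives one that contains `f`. Their supports are distinct cycles
    -- through `a`.
    · exfalso
      rw [hE, hE] at hpq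
      have hf : (⟨_, _, f⟩ : Quiver.Total V) ∈ arrowList p' := by
        have := hpq.mem_iff.2 (List.mem_cons_self)
        exact (List.mem_cons.1 this).resolve_left (Ne.symm hef)
      have he : (⟨_, _, e⟩ : Quiver.Total V) ∈ arrowList q' := by
        have := hpq.mem_iff.1 (List.mem_cons_self)
        exact (List.mem_cons.1 this).resolve_left hef
      obtain ⟨p₁, p₂, -, hp₁⟩ := exists_comp_of_mem_arrowList p' hf
      obtain ⟨q₁, q₂, -, hq₁⟩ := exists_comp_of_mem_arrowList q' he
      have hmem : ∀ {c : V} (e : a ⟶ c) (r : Quiver.Path c a),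
          (⟨_, _, e⟩ : Quiver.Total V) ∈ arrowList (e.toPath.comp r) := by
        intro c e r
        simp [Quiver.Hom.toPath]
      have := h a
        ⟨isOrientedCycle_support _ (hmem e p₁), mem_verts_support _ (hmem e p₁) rfl⟩
        ⟨isOrientedCycle_support _ (hmem f q₁), mem_verts_support _ (hmem f q₁) rfl⟩
      rw [support_eq_iff] at this
      have hcontra := (this _).2 (hmem f q₁)
      simp only [Quiver.Hom.toPath, arrowList_comp, arrowList_cons, arrowList_nil,
        List.nil_append, List.mem_append, List.mem_singleton] at hcontra
      exact hcontra.elim (fun h => hef h.symm) hp₁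

end PIQuiver

/-! ### Coefficients of noncommutative polynomials -/

namespace FreeAlgebra

variable {R X : Type*} [CommRing R]

theorem equivMonoidAlgebraFreeMonoid_prod (w : List X) :
    equivMonoidAlgebraFreeMonoid (w.map (ι R)).prod
      = MonoidAlgebra.single (FreeMonoid.ofList w) (1 : R) := by
  induction w with
  | nil => simp [MonoidAlgebra.one_def]
  | cons x w ih =>
    rw [List.map_cons, List.prod_cons, map_mul, ih]
    have : equivMonoidAlgebraFreeMonoid (ι R x)
        = MonoidAlgebra.single (FreeMonoid.of x) (1 : R) := by
      simp [equivMonoidAlgebraFreeMonoid]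
    rw [this, MonoidAlgebra.single_mul_single, one_mul]
    rfl

/-- The coefficient of a word in a noncommutative polynomial. -/
noncomputable def wordCoeff (w : List X) (f : FreeAlgebra R X) : R :=
  (equivMonoidAlgebraFreeMonoid f).coeff (FreeMonoid.ofList w)

theorem wordCoeff_add (w : List X) (f g : FreeAlgebra R X) :
    wordCoeff w (f + g) = wordCoeff w f + wordCoeff w g := by
  simp [wordCoeff]

theorem wordCoeff_smul (w : List X) (r : R) (f : FreeAlgebra R X) :
    wordCoeff w (r • f) = r * wordCoeff w f := by
  simp [wordCoeff]

open Classical in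
theorem wordCoeff_prod (w w' : List X) :
    wordCoeff w (w'.map (ι R)).prod = if w' = w then 1 else 0 := by
  rw [wordCoeff, equivMonoidAlgebraFreeMonoid_prod, MonoidAlgebra.coeff_single,
    Finsupp.single_apply]
  simp

theorem eq_zero_of_wordCoeff {f : FreeAlgebra R X} (h : ∀ w, wordCoeff w f = 0) : f = 0 := by
  apply (equivMonoidAlgebraFreeMonoid (R := R) (X := X)).injective
  rw [map_zero]
  ext w
  exact h (FreeMonoid.toList w)

theorem induction_words {P : FreeAlgebra R X → Prop} (zero : P 0)
    (add : ∀ f g, P f → P g → P (f + g)) (smul : ∀ (r : R) (w : List X), P (r • (w.map (ι R)).prod))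
    (f : FreeAlgebra R X) : P f := by
  rw [← (equivMonoidAlgebraFreeMonoid (R := R) (X := X)).symm_apply_apply f]
  induction equivMonoidAlgebraFreeMonoid f using MonoidAlgebra.induction_linear with
  | zero => simpa
  | add f g hf hg => rw [map_add]; exact add _ _ hf hg
  | single w r =>
    have : equivMonoidAlgebraFreeMonoid.symm (MonoidAlgebra.single w r)
        = r • ((FreeMonoid.toList w).map (ι R)).prod := by
      rw [AlgEquiv.symm_apply_eq, map_smul, equivMonoidAlgebraFreeMonoid_prod]
      simp
    rw [this]
    exact smul _ _

end FreeAlgebra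

namespace PIQuiver

theorem lift_standardPolynomial {F A : Type*} [Field F] [Ring A] [Algebra F A] (m : ℕ)
    (a : ℕ → A) : FreeAlgebra.lift F a (standardPolynomial F m)
      = standardEval fun i : Fin m => a i := by
  have : standardPolynomial F m = standardEval fun i : Fin m => FreeAlgebra.ι F (i : ℕ) := rfl
  rw [this, map_standardEval]
  simp

/-- Only the identity permutation produces the word `0, 1, …, m - 1`, whose coefficient is therefore
`1`. -/
theorem standardPolynomial_ne_zero (F : Type*) [Field F] (m : ℕ) :
    standardPolynomial F m ≠ 0 := by
  intro h
  have h1 := congrArg (FreeAlgebra.wordCoeff (List.ofFn fun i : Fin m => (i : ℕ))) h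
  let φ : FreeAlgebra F ℕ →+ F :=
    AddMonoidHom.mk' (FreeAlgebra.wordCoeff (List.ofFn fun i : Fin m => (i : ℕ)))
      (FreeAlgebra.wordCoeff_add _)
  have h2 : φ (standardPolynomial F m) = 1 := by
    rw [standardPolynomial, map_sum, Finset.sum_eq_single 1]
    · rw [map_zsmul]
      have : φ (List.ofFn fun i : Fin m => FreeAlgebra.ι F (((1 : Equiv.Perm (Fin m)) i : Fin m)
          : ℕ)).prod = 1 := by
        have h3 := FreeAlgebra.wordCoeff_prod (R := F) (List.ofFn fun i : Fin m => (i : ℕ))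
          (List.ofFn fun i : Fin m => (i : ℕ))
        rw [if_pos rfl, List.map_ofFn] at h3
        exact h3
      rw [this]
      simp
    · intro σ _ hσ
      rw [map_zsmul]
      have : φ (List.ofFn fun i : Fin m => FreeAlgebra.ι F ((σ i : Fin m) : ℕ)).prod = 0 := by
        have h3 := FreeAlgebra.wordCoeff_prod (R := F) (List.ofFn fun i : Fin m => (i : ℕ))
          (List.ofFn fun i : Fin m => ((σ i : Fin m) : ℕ))
        rw [if_neg, List.map_ofFn] at h3
        · exact h3
        · intro h4
          apply hσ
          ext i
          simpa using congrFun (List.ofFn_injective h4) i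
      rw [this, smul_zero]
    · simp
  have h0 : φ (standardPolynomial F m) = 0 := by rw [h, map_zero]
  exact one_ne_zero (h2.symm.trans h0)

/-! ### Free subalgebras and the generic matrix representation -/

namespace PathAlgebra

variable {F : Type w} {V : Type u} [Field F] [Quiver.{v} V]

/-- The coefficient of a path. -/
noncomputable def coeff (p : AnyPath V) : PathAlgebra F V →ₗ[F] F := Finsupp.lapply p

open Classical in
theorem coeff_ofPath (p : AnyPath V) {a b : V} (q : Quiver.Path a b) :
    coeff p (ofPath F q) = if (⟨a, b, q⟩ : AnyPath V) = p then 1 else 0 :=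
  Finsupp.single_apply

theorem eq_zero_of_coeff {x : PathAlgebra F V} (h : ∀ p, coeff p x = 0) : x = 0 :=
  Finsupp.ext h

/-- The concatenation of closed paths along a word. -/
def wordPath {X : Type*} {a : V} (c : X → Quiver.Path a a) : List X → Quiver.Path a a
  | [] => Quiver.Path.nil
  | x :: w => (c x).comp (wordPath c w)

theorem arrowList_wordPath {X : Type*} {a : V} (c : X → Quiver.Path a a) (w : List X) :
    arrowList (wordPath c w) = w.flatMap fun x => arrowList (c x) := by
  induction w with
  | nil => rfl
  | cons x w ih => simp [wordPath, ih]

theorem append_comm_ne {v : V} {c₁ c₂ : Quiver.Path v v} (h₁ : v ∈ (support c₁).verts)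
    (h₂ : v ∈ (support c₂).verts) (h : support c₁ ≠ support c₂) :
    arrowList c₁ ++ arrowList c₂ ≠ arrowList c₂ ++ arrowList c₁ := by
  obtain ⟨e₁, he₁, -⟩ := h₁
  obtain ⟨e₂, he₂, -⟩ := h₂
  rw [mem_pathArrows] at he₁ he₂
  exact fun hcomm => h ((support_eq_iff _ _).2
    (List.mem_iff_of_append_comm (List.ne_nil_of_mem he₁) (List.ne_nil_of_mem he₂) hcomm))

open Classical in
/-- The commutative monomial of a path. -/
noncomputable def weight {a b : V} (p : Quiver.Path a b) : Quiver.Total V →₀ ℕ :=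
  Multiset.toFinsupp (arrowList p : Multiset (Quiver.Total V))

theorem weight_comp {a b c : V} (p : Quiver.Path a b) (q : Quiver.Path b c) :
    weight (p.comp q) = weight p + weight q := by
  classical
  rw [weight, weight, weight, arrowList_comp, ← Multiset.coe_add, map_add]

open Classical in
/-- The generic representation of the path algebra by matrices of commutative polynomials. -/
noncomputable def toMatrixLin (F : Type w) (V : Type u) [Field F] [Quiver.{v} V] :
    PathAlgebra F V →ₗ[F] Matrix V V (MvPolynomial (Quiver.Total V) F) :=
  Finsupp.linearCombination F fun p : AnyPath V =>
    Matrix.single p.source p.target (MvPolynomial.monomial (weight p.path) 1)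

open Classical in
theorem toMatrixLin_ofPath {a b : V} (p : Quiver.Path a b) :
    toMatrixLin F V (ofPath F p) = Matrix.single a b (MvPolynomial.monomial (weight p) 1) := by
  unfold toMatrixLin ofPath
  erw [Finsupp.linearCombination_single, one_smul]

variable [Fintype V]

theorem ofPath_mul_lift_prod {X : Type*} {a b : V} (c : X → Quiver.Path a a) (w : List X)
    (q : Quiver.Path b a) :
    ofPath F q * FreeAlgebra.lift F (fun x => ofPath F (c x)) (w.map (FreeAlgebra.ι F)).prod
      = ofPath F (q.comp (wordPath c w)) := by
  induction w generalizing q with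
  | nil => simp [wordPath]
  | cons x w ih =>
    rw [List.map_cons, List.prod_cons, map_mul, ← mul_assoc, FreeAlgebra.lift_ι_apply,
      ofPath_mul_ofPath, ih, wordPath, Quiver.Path.comp_assoc]

/-- Closed paths that generate a free monoid generate a free unital subalgebra. -/
theorem lift_ofPath_injective {X : Type*} {a : V} (c : X → Quiver.Path a a)
    (hc : Function.Injective fun w : List X => w.flatMap fun x => arrowList (c x)) :
    Function.Injective (FreeAlgebra.lift F fun x => ofPath F (c x)) := by
  classical
  have hw : Function.Injective (wordPath c) := by
    intro w w' h
    apply hc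
    simp only [← arrowList_wordPath, h]
  rw [injective_iff_map_eq_zero]
  intro f hf
  refine FreeAlgebra.eq_zero_of_wordCoeff fun w => ?_
  -- The empty word maps to the sum of all lazy paths. Multiplying by the lazy path at `a` turns
  -- every word into a single closed path at `a`, so that path coefficients are word coefficients.
  have key : ∀ f : FreeAlgebra F X, coeff ⟨a, a, wordPath c w⟩
      (ofPath F (Quiver.Path.nil : Quiver.Path a a) *
        FreeAlgebra.lift F (fun x => ofPath F (c x)) f) = FreeAlgebra.wordCoeff w f := by
    intro f
    induction f using FreeAlgebra.induction_words with
    | zero => simp [FreeAlgebra.wordCoeff]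
    | add f g hf hg => rw [map_add, mul_add, map_add, hf, hg, FreeAlgebra.wordCoeff_add]
    | smul r w' =>
      rw [map_smul, mul_smul_comm, map_smul, ofPath_mul_lift_prod, FreeAlgebra.wordCoeff_smul,
        FreeAlgebra.wordCoeff_prod, Quiver.Path.nil_comp, coeff_ofPath, smul_eq_mul]
      simp [hw.eq_iff]
  rw [← key, hf, mul_zero, map_zero]

theorem toMatrixLin_mul (x y : PathAlgebra F V) :
    toMatrixLin F V (x * y) = toMatrixLin F V x * toMatrixLin F V y := by
  classical
  induction x using PathAlgebra.induction with
  | zero => simp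
  | add x x' h h' => simp only [add_mul, map_add, h, h']
  | smul r a b p =>
  induction y using PathAlgebra.induction with
  | zero => simp
  | add y y' h h' => simp only [mul_add, map_add, h, h']
  | smul s c d q =>
  simp only [smul_mul_assoc, mul_smul_comm, map_smul, toMatrixLin_ofPath]
  congr 2
  by_cases h : b = c
  · subst h
    rw [ofPath_mul_ofPath, toMatrixLin_ofPath, Matrix.single_mul_single_same,
      MvPolynomial.monomial_mul, one_mul, weight_comp]
  · rw [ofPath_mul_ofPath_of_ne _ _ h, map_zero, Matrix.single_mul_single_of_ne _ _ _ _ h]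

open Classical in
theorem toMatrixLin_one : toMatrixLin F V 1 = 1 := by
  rw [one_def, map_sum]
  simp only [toMatrixLin_ofPath]
  refine Matrix.ext fun i j => ?_
  rw [Matrix.sum_apply, Matrix.one_apply]
  by_cases h : i = j
  · subst h
    rw [Finset.sum_eq_single i (fun b _ hb => by simp [hb]) (by simp)]
    simp [weight]
  · rw [if_neg h]
    apply Finset.sum_eq_zero
    intro k _
    rw [Matrix.single_apply, if_neg]
    rintro ⟨rfl, rfl⟩
    exact h rfl

/-- No two paths with the same endpoints have the same monomial, so every path coefficient can be
read off from a matrix entry. -/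
theorem toMatrixLin_injective (h : DisjointCycles V) : Function.Injective (toMatrixLin F V) := by
  classical
  have key : ∀ (p : AnyPath V) (x : PathAlgebra F V),
      MvPolynomial.coeff (weight p.path) (toMatrixLin F V x p.source p.target) = coeff p x := by
    rintro ⟨a, b, p⟩ x
    induction x using PathAlgebra.induction with
    | zero => simp
    | add x y hx hy => simp only [map_add, Matrix.add_apply, MvPolynomial.coeff_add, hx, hy]
    | smul r c d q =>
      rw [map_smul, map_smul, toMatrixLin_ofPath, Matrix.smul_apply, MvPolynomial.coeff_smul,
        coeff_ofPath, Matrix.single_apply]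
      congr 1
      by_cases hcd : c = a ∧ d = b
      · obtain ⟨rfl, rfl⟩ := hcd
        rw [if_pos ⟨rfl, rfl⟩, MvPolynomial.coeff_monomial]
        refine if_congr ⟨fun hw => ?_, fun hw => ?_⟩ rfl rfl
        · rw [h.eq_of_perm q p (Multiset.coe_eq_coe.1 (Multiset.toFinsupp.injective hw))]
        · cases hw; rfl
      · rw [if_neg hcd, if_neg, MvPolynomial.coeff_zero]
        intro heq
        cases heq
        exact hcd ⟨rfl, rfl⟩
  rw [injective_iff_map_eq_zero]
  intro x hx
  refine eq_zero_of_coeff fun p => ?_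
  rw [← key, hx]
  simp

theorem standardPolynomial_isPolynomialIdentity (h : DisjointCycles V) :
    IsPolynomialIdentity F (PathAlgebra F V) (standardPolynomial F (2 * Fintype.card V)) := by
  classical
  intro a
  let φ : PathAlgebra F V →+* Matrix V V (MvPolynomial (Quiver.Total V) F) :=
    { toMatrixLin F V with
      map_one' := toMatrixLin_one
      map_mul' := toMatrixLin_mul
      map_zero' := (toMatrixLin F V).map_zero }
  have hφ : Function.Injective φ := toMatrixLin_injective h
  apply hφ
  rw [lift_standardPolynomial, map_standardEval, map_zero]
  exact standardEval_matrix _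

/-- Two closed paths that generate a free monoid generate a free algebra. -/
theorem exists_freeAlgebra_equiv_adjoin {v : V} {c₁ c₂ : Quiver.Path v v}
    (h : arrowList c₁ ++ arrowList c₂ ≠ arrowList c₂ ++ arrowList c₁) :
    ∃ e : FreeAlgebra F (Fin 2) ≃ₐ[F]
      Algebra.adjoin F ({ofPath F c₁, ofPath F c₂} : Set (PathAlgebra F V)),
      (e (FreeAlgebra.ι F 0) : PathAlgebra F V) = ofPath F c₁ ∧
      (e (FreeAlgebra.ι F 1) : PathAlgebra F V) = ofPath F c₂ := by
  let c : Fin 2 → Quiver.Path v v := ![c₁, c₂]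
  have hc : Function.Injective fun w : List (Fin 2) => w.flatMap fun x => arrowList (c x) := by
    intro x y hxy
    have hmap : ∀ z : List (Fin 2), (z.flatMap fun x => arrowList (c x))
        = (z.map finTwoEquiv).flatMap fun b => cond b (arrowList c₂) (arrowList c₁) := by
      intro z
      rw [List.flatMap_map]
      congr 1
      ext i : 1
      fin_cases i <;> rfl
    simp only [hmap] at hxy
    exact finTwoEquiv.injective.list_map (List.flatMap_cond_injective h hxy)
  have hinj := lift_ofPath_injective (F := F) c hc
  have hrange : (FreeAlgebra.lift F fun x => ofPath F (c x)).range
      = Algebra.adjoin F ({ofPath F c₁, ofPath F c₂} : Set (PathAlgebra F V)) := by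
    rw [← Algebra.adjoin_range_eq_range_freeAlgebra_lift]
    congr 1
    ext x
    simp [c, eq_comm]
  refine ⟨(AlgEquiv.ofInjective _ hinj).trans (Subalgebra.equivOfEq _ _ hrange), ?_, ?_⟩
  · exact FreeAlgebra.lift_ι_apply _ _
  · exact FreeAlgebra.lift_ι_apply _ _

/-- The closed paths `c₂ ^ n c₁` freely generate a free algebra of countable rank, so substituting
them for the variables is injective. -/
theorem eq_zero_of_isPolynomialIdentity {v : V} {c₁ c₂ : Quiver.Path v v}
    (h : arrowList c₁ ++ arrowList c₂ ≠ arrowList c₂ ++ arrowList c₁) (f : FreeAlgebra F ℕ)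
    (hf : IsPolynomialIdentity F (PathAlgebra F V) f) : f = 0 := by
  let d : Bool → Quiver.Path v v := fun b => cond b c₂ c₁
  let c : ℕ → Quiver.Path v v := fun n => wordPath d (List.replicate n true ++ [false])
  have hc : Function.Injective fun w : List ℕ => w.flatMap fun x => arrowList (c x) := by
    intro x y hxy
    have hmap : ∀ z : List ℕ, (z.flatMap fun x => arrowList (c x))
        = (z.flatMap fun n => List.replicate n true ++ [false]).flatMap
          fun b => cond b (arrowList c₂) (arrowList c₁) := by
      intro z
      rw [List.flatMap_assoc]
      congr 1
      ext i : 1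
      rw [arrowList_wordPath]
      congr 1
      ext b : 1
      cases b <;> rfl
    simp only [hmap] at hxy
    exact List.flatMap_replicate_injective (List.flatMap_cond_injective h hxy)
  apply lift_ofPath_injective (F := F) c hc
  rw [hf, map_zero]

end PathAlgebra

end PIQuiver

/-! ### The theorem -/

theorem theorem6p2 {F : Type w} [Field F] {V : Type u} [Fintype V] [Quiver.{v} V]
    [∀ a b : V, Finite (a ⟶ b)] :
    (PIQuiver.IsPI F (PIQuiver.PathAlgebra F V) ↔
      ∀ v : V, {C : PIQuiver.Subquiver V | C.IsOrientedCycle ∧ v ∈ C.verts}.Subsingleton) ∧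
    ((∀ v : V, {C : PIQuiver.Subquiver V | C.IsOrientedCycle ∧ v ∈ C.verts}.Subsingleton) →
      PIQuiver.IsPolynomialIdentity F (PIQuiver.PathAlgebra F V)
        (PIQuiver.standardPolynomial F (2 * Fintype.card V))) ∧
    (∀ (v : V) (C₁ C₂ : PIQuiver.Subquiver V),
      C₁.IsOrientedCycle → C₂.IsOrientedCycle → v ∈ C₁.verts → v ∈ C₂.verts → C₁ ≠ C₂ →
      (∃ c₁ : Quiver.Path v v, PIQuiver.support c₁ = C₁) ∧
      (∃ c₂ : Quiver.Path v v, PIQuiver.support c₂ = C₂) ∧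
      (∀ c₁ c₂ : Quiver.Path v v, PIQuiver.support c₁ = C₁ → PIQuiver.support c₂ = C₂ →
        ∃ e : FreeAlgebra F (Fin 2) ≃ₐ[F]
            Algebra.adjoin F ({PIQuiver.PathAlgebra.ofPath F c₁,
              PIQuiver.PathAlgebra.ofPath F c₂} : Set (PIQuiver.PathAlgebra F V)),
          (e (FreeAlgebra.ι F 0) : PIQuiver.PathAlgebra F V) = PIQuiver.PathAlgebra.ofPath F c₁ ∧
          (e (FreeAlgebra.ι F 1) : PIQuiver.PathAlgebra F V) =
            PIQuiver.PathAlgebra.ofPath F c₂) ∧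
      ∀ f : FreeAlgebra F ℕ,
        PIQuiver.IsPolynomialIdentity F (PIQuiver.PathAlgebra F V) f → f = 0) := by
  have hfree : ∀ (v : V) (C₁ C₂ : PIQuiver.Subquiver V),
      C₁.IsOrientedCycle → C₂.IsOrientedCycle → v ∈ C₁.verts → v ∈ C₂.verts → C₁ ≠ C₂ →
      ∀ f : FreeAlgebra F ℕ,
        PIQuiver.IsPolynomialIdentity F (PIQuiver.PathAlgebra F V) f → f = 0 := by
    intro v C₁ C₂ h₁ h₂ hv₁ hv₂ hne
    obtain ⟨c₁, rfl⟩ := PIQuiver.exists_closed_path_of_mem_verts h₁ hv₁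
    obtain ⟨c₂, rfl⟩ := PIQuiver.exists_closed_path_of_mem_verts h₂ hv₂
    exact PIQuiver.PathAlgebra.eq_zero_of_isPolynomialIdentity
      (PIQuiver.PathAlgebra.append_comm_ne hv₁ hv₂ hne)
  refine ⟨⟨?_, fun h => ⟨_, PIQuiver.standardPolynomial_ne_zero F _,
    PIQuiver.PathAlgebra.standardPolynomial_isPolynomialIdentity h⟩⟩,
    PIQuiver.PathAlgebra.standardPolynomial_isPolynomialIdentity, ?_⟩
  · rintro ⟨f, hf, hid⟩ v C₁ ⟨h₁, hv₁⟩ C₂ ⟨h₂, hv₂⟩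
    by_contra hne
    exact hf (hfree v C₁ C₂ h₁ h₂ hv₁ hv₂ hne f hid)
  · intro v C₁ C₂ h₁ h₂ hv₁ hv₂ hne
    refine ⟨PIQuiver.exists_closed_path_of_mem_verts h₁ hv₁,
      PIQuiver.exists_closed_path_of_mem_verts h₂ hv₂, ?_, hfree v C₁ C₂ h₁ h₂ hv₁ hv₂ hne⟩
    rintro c₁ c₂ rfl rfl
    exact PIQuiver.PathAlgebra.exists_freeAlgebra_equiv_adjoin
      (PIQuiver.PathAlgebra.append_comm_ne hv₁ hv₂ hne)
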